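/- Let $X$ be a finite set with $n=|X|\geq 3$, and let $T(X)$ be the semigroup of all functions from $X$ to $X$ under composition. Let $2\leq r<n$, and let $J_r=\{a\in T(X): |\mathrm{im}(a)|\leq r\}$ be the ideal of transformations of rank at most $r$. The commuting graph of $J_r$ is the simple graph whose vertices are the elements of $J_r$ outside the center $Z(J_r)=\{a\in J_r: ab=ba\text{ for all }b\in J_r\}$, with two vertices $a,b$ adjacent if and only if $a\neq b$ and $ab=ba$. The diameter of a graph is the maximum, over all pairs of vertices, of the length of a shortest path between them (it is $\infty$ if some two vertices are joined by no path). 1. If $n=3$, or if $n\in\{5,6,7\}$ and $r=4$, then the commuting graph of $J_r$ has diameter $4$. 2. In all other cases, the commuting graph of $J_r$ has diameter $5$. -/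

import Mathlib

/-- The commuting graph of a semigroup `S`: the vertices are the non-central elements of `S`, and
two vertices are adjacent when they are distinct and commute. -/
def commutingGraph (S : Type*) [Semigroup S] : SimpleGraph {a : S // a ∉ Set.center S} where
  Adj a b := a ≠ b ∧ (a : S) * (b : S) = (b : S) * (a : S)
  symm := ⟨fun _ _ h => ⟨h.1.symm, h.2.symm⟩⟩
  loopless := ⟨fun _ h => h.1 rfl⟩

/-- The rank of a transformation of `X`, that is, the cardinality of its image. The monoid `T(X)`
of full transformations of `X` under composition is `Function.End X`. -/
noncomputable def transformationRank {X : Type*} (a : Function.End X) : ℕ :=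
  (Set.range (a : X → X)).ncard

theorem transformationRank_mul_le_left {X : Type*} [Finite X] (a b : Function.End X) :
    transformationRank (a * b) ≤ transformationRank a :=
  Set.ncard_le_ncard (Set.range_comp_subset_range (b : X → X) (a : X → X)) (Set.toFinite _)

theorem transformationRank_mul_le_right {X : Type*} [Finite X] (a b : Function.End X) :
    transformationRank (a * b) ≤ transformationRank b := by
  have h : Set.range ((a * b : Function.End X) : X → X) = (a : X → X) '' Set.range (b : X → X) :=
    Set.range_comp (a : X → X) (b : X → X)
  unfold transformationRank
  rw [h]
  exact Set.ncard_image_le (Set.toFinite _)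

/-- `J_r`: the transformations of `X` of rank at most `r`, as a subsemigroup of `T(X)`. -/
def rankIdeal (X : Type*) [Finite X] (r : ℕ) : Subsemigroup (Function.End X) where
  carrier := {a | transformationRank a ≤ r}
  mul_mem' {a b} ha _ := (transformationRank_mul_le_left a b).trans ha

/-- `J_r` is a two-sided ideal of `T(X)`. -/
theorem rankIdeal_isTwoSided (X : Type*) [Finite X] (r : ℕ) (a t : Function.End X)
    (ha : a ∈ rankIdeal X r) : t * a ∈ rankIdeal X r ∧ a * t ∈ rankIdeal X r :=
  ⟨(transformationRank_mul_le_right t a).trans ha, (transformationRank_mul_le_left a t).trans ha⟩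

/-!
Some power of every transformation is idempotent and commutes with whatever the transformation
commutes with, so the distance of two elements of `J_r` exceeds that of suitable idempotents `e`,
`f` by at most 2. A constant map commutes with `e` as soon as its value is fixed by `e`; one
further map of rank at most 2 leads from it to `f`, so the diameter is at most 5. If `e * f` fixes
a point or has rank at most 2 (and `4 ≤ r`), a single map links `e` and `f`. This settles `n = 3`.
For `r = 4` and `n ≤ 7`, the ranges of `e` and `f` can be assumed disjoint and `e = a ^ (N + 1)` of
rank at most 3. Then the rank of `e * f` is at most `2 * (rank a - rank e)`, hence at most 2,
unless some `q` fixed by `f` lies outside the range of `a` while `a q` is fixed by `e`; in that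
case extending `e` by fixing `q` gives a shorter route from `a` to the constant map `q`.

For the lower bounds, let `a` be unicyclic with a tail so long that the range of an element of `J_r`
commuting with `a` cannot contain the whole tail. All these elements have the collapse `e` of `a`
onto its cycle as a power, so the distance from `a` to a transformation `b` of the same kind
exceeds that of the collapses `e` and `f` by exactly 2. If the cycles are disjoint, `e` and `f` do
not commute, and if they are placed so that collapsing from one to the other and back is a rotation
by one step, then anything commuting with `e` and `f` rotates both cycles of length `m`. It
therefore has rank at least `2 * m`, and more than that if a further point is in step with neither
cycle.
-/

/-- `a` and `b` are joined by a walk of length `k + 1` in which neighbours commute and the `k`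
inner terms belong to `S`. Neighbours may coincide, so this is a bound on the distance, not its
exact value. -/
def CommutingChain {M : Type*} [Mul M] (S : Set M) : ℕ → M → M → Prop
  | 0, a, b => Commute a b
  | k + 1, a, b => ∃ c ∈ S, Commute a c ∧ CommutingChain S k c b

namespace CommutingChain

section Mul

variable {M N : Type*} [Mul M] [Mul N] {S : Set M} {k : ℕ} {a b c : M}

theorem snoc (h : CommutingChain S k a b) (hb : b ∈ S) (hbc : Commute b c) :
    CommutingChain S (k + 1) a c := by
  induction k generalizing a with
  | zero => exact ⟨b, hb, h, hbc⟩
  | succ k ih =>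
    obtain ⟨d, hd, had, hdb⟩ := h
    exact ⟨d, hd, had, ih hdb⟩

theorem symm (h : CommutingChain S k a b) : CommutingChain S k b a := by
  induction k generalizing a with
  | zero => exact Commute.symm h
  | succ k ih =>
    obtain ⟨c, hc, hac, hcb⟩ := h
    exact (ih hcb).snoc hc hac.symm

theorem map {T : Set N} (φ : M →ₙ* N) (hφ : Set.MapsTo φ S T) (h : CommutingChain S k a b) :
    CommutingChain T k (φ a) (φ b) := by
  induction k generalizing a with
  | zero => exact Commute.map h φ
  | succ k ih =>
    obtain ⟨c, hc, hac, hcb⟩ := h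
    exact ⟨φ c, hφ hc, hac.map φ, ih hcb⟩

theorem mono {T : Set M} (hST : S ⊆ T) (h : CommutingChain S k a b) : CommutingChain T k a b :=
  h.map (MulHom.id M) hST

end Mul

section Monoid

variable {M : Type*} [Monoid M] {S : Set M} {k : ℕ} {a b : M}

theorem pow_left (h : CommutingChain S k a b) (n : ℕ) : CommutingChain S k (a ^ n) b := by
  cases k with
  | zero => exact Commute.pow_left h n
  | succ k =>
    obtain ⟨c, hc, hac, hcb⟩ := h
    exact ⟨c, hc, hac.pow_left n, hcb⟩

theorem of_pow {m n : ℕ} (ha : a ^ m ∈ S) (hb : b ^ n ∈ S)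
    (h : CommutingChain S k (a ^ m) (b ^ n)) : CommutingChain S (k + 2) a b :=
  ⟨a ^ m, ha, .self_pow a m, h.snoc hb (.pow_self b n)⟩

end Monoid

end CommutingChain

theorem exists_pow_isIdempotentElem {M : Type*} [Monoid M] [Finite M] (a : M) :
    ∃ n ≠ 0, IsIdempotentElem (a ^ n) := by
  -- The Ellis-Numakura lemma for the discrete topology on the set of powers of `a`.
  let _ : TopologicalSpace M := ⊥
  have : DiscreteTopology M := ⟨rfl⟩
  obtain ⟨_, ⟨n, hn, rfl⟩, h⟩ := exists_idempotent_in_compact_subsemigroup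
    (fun _ : M => continuous_of_discreteTopology) {b | ∃ n ≠ 0, a ^ n = b}
    ⟨a ^ 1, 1, one_ne_zero, rfl⟩ (Set.toFinite _).isCompact <| by
      rintro _ ⟨i, hi, rfl⟩ _ ⟨j, -, rfl⟩
      exact ⟨i + j, by omega, pow_add a i j⟩
  exact ⟨n, hn, h⟩

theorem pow_mem_of_ne_zero {M : Type*} [Monoid M] (S : Subsemigroup M) {a : M} (ha : a ∈ S)
    {n : ℕ} (hn : n ≠ 0) : a ^ n ∈ S := by
  induction n, Nat.one_le_iff_ne_zero.2 hn using Nat.le_induction with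
  | base => rwa [pow_one]
  | succ n _ ih => rw [pow_succ]; exact S.mul_mem (ih (by omega)) ha

theorem commutingChain_add_two_of_isIdempotentElem {M : Type*} [Monoid M] [Finite M]
    {S : Subsemigroup M} {k : ℕ}
    (h : ∀ e ∈ S, ∀ f ∈ S, IsIdempotentElem e → IsIdempotentElem f → CommutingChain S k e f)
    {a b : M} (ha : a ∈ S) (hb : b ∈ S) : CommutingChain S (k + 2) a b := by
  obtain ⟨m, hm, he⟩ := exists_pow_isIdempotentElem a
  obtain ⟨n, hn, hf⟩ := exists_pow_isIdempotentElem b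
  have hea := pow_mem_of_ne_zero S ha hm
  have hfb := pow_mem_of_ne_zero S hb hn
  exact .of_pow hea hfb (h _ hea _ hfb he hf)

theorem edist_le_add_one_iff {V : Type*} {G : SimpleGraph V} {u v : V} {n : ℕ} :
    G.edist u v ≤ (n + 1 : ℕ) ↔ ∃ w, G.edist u w ≤ 1 ∧ G.edist w v ≤ n := by
  refine ⟨fun h => ?_, fun ⟨w, huw, hwv⟩ => ?_⟩
  · obtain ⟨p, hp⟩ := G.exists_walk_of_edist_ne_top (ne_top_of_le_ne_top (ENat.natCast_ne_top _) h)
    rw [← hp, Nat.cast_le] at h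
    cases p with
    | nil => exact ⟨u, by simp, by simp⟩
    | @cons _ w _ huw q =>
      exact ⟨w, SimpleGraph.edist_le_one_iff_adj_or_eq.2 (.inl huw),
        q.edist_le.trans (Nat.cast_le.2 (Nat.le_of_succ_le_succ h))⟩
  · rw [Nat.cast_succ, add_comm]
    exact SimpleGraph.edist_triangle.trans (add_le_add huw hwv)

section CommutingGraph

variable {M : Type*} [Semigroup M] {S : Subsemigroup M}

theorem edist_commutingGraph_le_one_iff {a b : {a : S // a ∉ Set.center S}} :
    (commutingGraph S).edist a b ≤ 1 ↔ Commute (a.1 : M) b.1 := by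
  rw [SimpleGraph.edist_le_one_iff_adj_or_eq]
  constructor
  · rintro (hab | rfl)
    · exact congrArg Subtype.val hab.2
    · exact Commute.refl _
  · intro hab
    exact or_iff_not_imp_right.2 fun hne => ⟨hne, Subtype.ext hab⟩

theorem edist_commutingGraph_le_iff (hS : Set.center S = ∅) {k : ℕ}
    {a b : {a : S // a ∉ Set.center S}} :
    (commutingGraph S).edist a b ≤ (k + 1 : ℕ) ↔ CommutingChain (S : Set M) k a.1 b.1 := by
  induction k generalizing a with
  | zero => exact edist_commutingGraph_le_one_iff
  | succ k ih =>
    simp only [edist_le_add_one_iff (n := k + 1), ih, edist_commutingGraph_le_one_iff]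
    exact ⟨fun ⟨c, hac, hcb⟩ => ⟨c.1, c.1.2, hac, hcb⟩,
      fun ⟨c, hc, hac, hcb⟩ => ⟨⟨⟨c, hc⟩, by simp [hS]⟩, hac, hcb⟩⟩

theorem ediam_commutingGraph_le_iff (hS : Set.center S = ∅) {k : ℕ} :
    (commutingGraph S).ediam ≤ (k + 1 : ℕ) ↔
      ∀ a ∈ S, ∀ b ∈ S, CommutingChain (S : Set M) k a b := by
  simp only [SimpleGraph.ediam_le_iff, edist_commutingGraph_le_iff hS]
  exact ⟨fun h a ha b hb => h ⟨⟨a, ha⟩, by simp [hS]⟩ ⟨⟨b, hb⟩, by simp [hS]⟩,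
    fun h a b => h _ a.1.2 _ b.1.2⟩

theorem ediam_commutingGraph_eq_iff (hS : Set.center S = ∅) {k : ℕ} :
    (commutingGraph S).ediam = (k + 2 : ℕ) ↔
      (∀ a ∈ S, ∀ b ∈ S, CommutingChain (S : Set M) (k + 1) a b) ∧
        ∃ a ∈ S, ∃ b ∈ S, ¬ CommutingChain (S : Set M) k a b := by
  have h_lt : (commutingGraph S).ediam ≤ (k + 1 : ℕ) ↔ (commutingGraph S).ediam < (k + 2 : ℕ) := by
    rw [← ENat.lt_add_one_iff (ENat.natCast_ne_top _)]
    norm_cast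
  rw [← ediam_commutingGraph_le_iff hS, le_antisymm_iff, and_congr_right_iff]
  intro _
  rw [← not_lt, ← h_lt, ediam_commutingGraph_le_iff hS]
  push Not
  rfl

end CommutingGraph

instance {X : Type*} [Finite X] : Finite (Function.End X) :=
  inferInstanceAs (Finite (X → X))

theorem commute_iff_forall_apply {X : Type*} {a b : Function.End X} :
    Commute a b ↔ ∀ z, a (b z) = b (a z) :=
  funext_iff

theorem pow_succ_apply {X : Type*} (a : Function.End X) (k : ℕ) (z : X) :
    (a ^ (k + 1)) z = a ((a ^ k) z) :=
  congrFun (pow_succ' a k) z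

theorem commute_const {X : Type*} {a : Function.End X} {x : X} (h : a x = x) :
    Commute a (Function.const X x) :=
  commute_iff_forall_apply.2 fun _ => h

theorem apply_eq_self_of_mem_range {X : Type*} {e : Function.End X} (he : IsIdempotentElem e)
    {x : X} (hx : x ∈ Set.range e) : e x = x := by
  obtain ⟨z, rfl⟩ := hx
  exact congrFun he.eq z

section Rank

variable {X : Type*} [Finite X]

theorem rankIdeal_mono {r s : ℕ} (h : r ≤ s) : rankIdeal X r ≤ rankIdeal X s :=
  fun _ ha => ha.trans h

theorem pair_mem_rankIdeal_two {a : Function.End X} (x y : X) (h : ∀ z, a z = x ∨ a z = y) :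
    a ∈ rankIdeal X 2 :=
  (Set.ncard_le_ncard (Set.range_subset_iff.2 h) (Set.toFinite {x, y})).trans
    (Set.ncard_insert_le x {y} |>.trans_eq (by simp))

theorem const_mem_rankIdeal_one (x : X) : Function.const X x ∈ rankIdeal X 1 :=
  (Set.ncard_le_ncard Set.range_const_subset (Set.toFinite {x})).trans (Set.ncard_singleton x).le

theorem center_rankIdeal_eq_empty {r : ℕ} (hr : 1 ≤ r) (hrn : r < Nat.card X) :
    Set.center (rankIdeal X r) = ∅ := by
  refine Set.eq_empty_of_forall_notMem fun a ha => hrn.not_ge ?_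
  have h_fixes : ∀ x, a.1 x = x := fun x =>
    congrFun (congrArg Subtype.val ((Set.mem_center_iff.1 ha).comm
      ⟨Function.const X x, rankIdeal_mono hr (const_mem_rankIdeal_one x)⟩)) x
  have h_range : Set.range a.1 = Set.univ := Set.eq_univ_of_forall fun x => ⟨x, h_fixes x⟩
  rw [← Set.ncard_univ, ← h_range]
  exact a.2

theorem transformationRank_add_le_card {e f : Function.End X}
    (h : Disjoint (Set.range e) (Set.range f)) :
    transformationRank e + transformationRank f ≤ Nat.card X :=
  (Set.ncard_union_eq h).symm.le.trans (Set.ncard_le_card _)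

end Rank

section Idempotent

variable {X : Type*} [Finite X] {e f : Function.End X}

theorem exists_commute_fixing (hf : IsIdempotentElem f) (x : X) :
    ∃ g ∈ rankIdeal X 2, g x = x ∧ Commute g f := by
  classical
  refine ⟨fun z => if z = x then x else f x, pair_mem_rankIdeal_two x (f x)
    fun z => ite_eq_or_eq .., if_pos rfl, commute_iff_forall_apply.2 fun z => ?_⟩
  have hff : ∀ w, f (f w) = f w := congrFun hf.eq
  by_cases hz : f z = x
  · have hx : f x = x := hz ▸ hff z
    simp [hx]
  · simp [hz, apply_ite f, hff]

theorem commutingChain_two_of_isIdempotentElem [Nonempty X] (he : IsIdempotentElem e)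
    (hf : IsIdempotentElem f) : CommutingChain (rankIdeal X 2) 2 e f := by
  obtain ⟨x, hx⟩ := Set.range_nonempty e
  obtain ⟨g, hg, hgx, hgf⟩ := exists_commute_fixing hf x
  exact ⟨Function.const X x, rankIdeal_mono one_le_two (const_mem_rankIdeal_one x),
    commute_const (apply_eq_self_of_mem_range he hx), g, hg, (commute_const hgx).symm, hgf⟩

theorem commutingChain_one_of_not_disjoint_range (he : IsIdempotentElem e)
    (hf : IsIdempotentElem f) (h : ¬ Disjoint (Set.range e) (Set.range f)) :
    CommutingChain (rankIdeal X 1) 1 e f := by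
  obtain ⟨x, hxe, hxf⟩ := Set.not_disjoint_iff.1 h
  exact ⟨Function.const X x, const_mem_rankIdeal_one x,
    commute_const (apply_eq_self_of_mem_range he hxe),
    (commute_const (apply_eq_self_of_mem_range hf hxf)).symm⟩

theorem commutingChain_one_of_apply_apply_eq (he : IsIdempotentElem e) (hf : IsIdempotentElem f)
    {x : X} (hx : e (f x) = x) : CommutingChain (rankIdeal X 2) 1 e f := by
  classical
  by_cases hd : Disjoint (Set.range e) (Set.range f)
  · have hff : ∀ z, f (f z) = f z := congrFun hf.eq
    have hex : e x = x := apply_eq_self_of_mem_range he ⟨_, hx⟩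
    have hfe : ∀ z, f (e z) ≠ e z := fun z hz =>
      Set.disjoint_left.1 hd (Set.mem_range_self z) ⟨_, hz⟩
    refine ⟨fun z => if f z = z then f x else x, pair_mem_rankIdeal_two (f x) x
      fun z => ite_eq_or_eq .., commute_iff_forall_apply.2 fun z => ?_,
      commute_iff_forall_apply.2 fun z => ?_⟩
    · simp [hfe, apply_ite e, hx, hex]
    · simp [hff, apply_ite f]
  · exact (commutingChain_one_of_not_disjoint_range he hf hd).mono (rankIdeal_mono one_le_two)

theorem commutingChain_one_of_transformationRank_mul_le_one [Nonempty X] (he : IsIdempotentElem e)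
    (hf : IsIdempotentElem f) (h : transformationRank (e * f) ≤ 1) :
    CommutingChain (rankIdeal X 2) 1 e f := by
  obtain ⟨x, hx⟩ := Set.range_nonempty (e * f)
  exact commutingChain_one_of_apply_apply_eq he hf
    ((Set.ncard_le_one (Set.toFinite _)).1 h _ (Set.mem_range_self x) _ hx)

theorem commutingChain_one_of_card_le_three [Nonempty X] (hX : Nat.card X ≤ 3)
    (he : IsIdempotentElem e) (hf : IsIdempotentElem f) :
    CommutingChain (rankIdeal X 2) 1 e f := by
  by_cases hd : Disjoint (Set.range e) (Set.range f)
  · have := transformationRank_add_le_card hd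
    refine commutingChain_one_of_transformationRank_mul_le_one he hf ?_
    rcases le_or_gt (transformationRank e) 1 with h | h
    · exact (transformationRank_mul_le_left e f).trans h
    · exact (transformationRank_mul_le_right e f).trans (by omega)
  · exact (commutingChain_one_of_not_disjoint_range he hf hd).mono (rankIdeal_mono one_le_two)

theorem apply_eq_or_eq_of_transformationRank_le_two {h : Function.End X}
    (h_rank : transformationRank h ≤ 2) {z : X} (hz : h (h z) ≠ h z) (w : X) :
    h w = h (h z) ∨ h w = h z := by
  have h_range : {h (h z), h z} = Set.range h := by
    refine Set.eq_of_subset_of_ncard_le (Set.pair_subset ⟨_, rfl⟩ ⟨_, rfl⟩) ?_ (Set.toFinite _)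
    rwa [Set.ncard_pair hz]
  exact h_range.ge (Set.mem_range_self w)

theorem commutingChain_one_of_transformationRank_mul_le_two [Nonempty X] (he : IsIdempotentElem e)
    (hf : IsIdempotentElem f) (h : transformationRank (e * f) ≤ 2) :
    CommutingChain (rankIdeal X 4) 1 e f := by
  classical
  by_cases h_fix : ∃ x, e (f x) = x
  · obtain ⟨x, hx⟩ := h_fix
    exact (commutingChain_one_of_apply_apply_eq he hf hx).mono (rankIdeal_mono (by norm_num))
  push Not at h_fix
  have hee : ∀ z, e (e z) = e z := congrFun he.eq
  have hff : ∀ z, f (f z) = f z := congrFun hf.eq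
  -- As `e * f` has rank at most 2 and no fixed point, it exchanges its two values. So if
  -- `e (f (e z)) ≠ e (f z)`, then `e (f (e z)) = e (f (e (f z)))`, whence `g` commutes with `e`.
  let g : Function.End X := fun z =>
    if e (f (e z)) = e (f z) then e (f z) else f (e (f z))
  have h_range : Set.range g ⊆ Set.range (e * f) ∪ Set.range (f * (e * f)) := by
    rintro _ ⟨z, rfl⟩
    by_cases hz : e (f (e z)) = e (f z)
    · exact .inl ⟨z, (if_pos hz).symm⟩
    · exact .inr ⟨z, (if_neg hz).symm⟩
  have hg : transformationRank g ≤ 4 := by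
    have := Set.ncard_le_ncard h_range (Set.toFinite _)
    have := Set.ncard_union_le (Set.range (e * f)) (Set.range (f * (e * f)))
    have := transformationRank_mul_le_right f (e * f)
    unfold transformationRank at *
    omega
  refine ⟨g, hg, commute_iff_forall_apply.2 fun z => ?_, commute_iff_forall_apply.2 fun z => ?_⟩
  · have hz := apply_eq_or_eq_of_transformationRank_le_two h (h_fix (e (f z))) (e z)
    by_cases hez : e (f (e z)) = e (f z)
    · simp [g, hee, hez]
    · simpa [g, hee, hez] using! (hz.resolve_right hez).symm
  · simp [g, hff, h_fix, apply_ite f]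

end Idempotent

section RankFour

variable {X : Type*} [Finite X]

theorem transformationRank_pow_succ_mul_le {a f : Function.End X} {N : ℕ}
    (hd : Disjoint (Set.range (a ^ (N + 1))) (Set.range f))
    (h : ∀ q ∈ Set.range f, q ∉ Set.range a → a q ∉ Set.range (a ^ (N + 1))) :
    transformationRank (a ^ (N + 1) * f) ≤
      2 * (transformationRank a - transformationRank (a ^ (N + 1))) := by
  set D := Set.range a \ Set.range (a ^ (N + 1)) with hD
  have h_sub : Set.range (a ^ (N + 1)) ⊆ Set.range a := by
    rw [pow_succ']
    exact Set.range_comp_subset_range (a ^ N) a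
  have h_range : Set.range (a ^ (N + 1) * f) ⊆ (a ^ (N + 1)) '' D ∪ (a ^ N) '' D := by
    rintro _ ⟨z, rfl⟩
    by_cases hz : f z ∈ Set.range a
    · exact .inl ⟨f z, ⟨hz, Set.disjoint_right.1 hd ⟨z, rfl⟩⟩, rfl⟩
    · exact .inr ⟨a (f z), ⟨⟨_, rfl⟩, h _ ⟨z, rfl⟩ hz⟩, rfl⟩
  calc transformationRank (a ^ (N + 1) * f) ≤ ((a ^ (N + 1)) '' D ∪ (a ^ N) '' D).ncard :=
        Set.ncard_le_ncard h_range (Set.toFinite _)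
    _ ≤ D.ncard + D.ncard := (Set.ncard_union_le _ _).trans
        (add_le_add (Set.ncard_image_le (Set.toFinite _)) (Set.ncard_image_le (Set.toFinite _)))
    _ = 2 * (transformationRank a - transformationRank (a ^ (N + 1))) := by
        rw [← two_mul, hD, Set.ncard_sdiff h_sub, transformationRank, transformationRank]

theorem exists_commute_fixing_of_notMem_range {a e : Function.End X} {q : X} {r : ℕ}
    (he : e ∈ rankIdeal X r) (hae : Commute a e) (hq : q ∉ Set.range a) (haq : e (a q) = a q) :
    ∃ g ∈ rankIdeal X (r + 1), g q = q ∧ Commute a g := by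
  classical
  let g : Function.End X := fun z => if z = q then q else e z
  have h_range : Set.range g ⊆ insert q (Set.range e) := by
    rintro _ ⟨z, rfl⟩
    exact (ite_eq_or_eq (z = q) q (e z)).imp_right fun h => ⟨z, h.symm⟩
  refine ⟨g, (Set.ncard_le_ncard h_range (Set.toFinite _)).trans
    ((Set.ncard_insert_le _ _).trans (Nat.succ_le_succ he)), if_pos rfl,
    commute_iff_forall_apply.2 fun z => ?_⟩
  have haz : a z ≠ q := fun h => hq ⟨z, h⟩
  by_cases hz : z = q
  · simp [g, hz, haq]
  · simp [g, hz, haz, commute_iff_forall_apply.1 hae z]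

theorem commutingChain_three_of_transformationRank_pow_le_three [Nonempty X] {a b : Function.End X}
    {m n : ℕ} (ha : a ∈ rankIdeal X 4) (hb : b ∈ rankIdeal X 4) (hm : m ≠ 0) (hn : n ≠ 0)
    (he : IsIdempotentElem (a ^ m)) (hf : IsIdempotentElem (b ^ n))
    (h3 : transformationRank (a ^ m) ≤ 3) : CommutingChain (rankIdeal X 4) 3 a b := by
  have h_of_pow : CommutingChain (rankIdeal X 4) 1 (a ^ m) (b ^ n) →
      CommutingChain (rankIdeal X 4) 3 a b :=
    .of_pow (pow_mem_of_ne_zero _ ha hm) (pow_mem_of_ne_zero _ hb hn)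
  by_cases hd : Disjoint (Set.range (a ^ m)) (Set.range (b ^ n))
  swap
  · exact h_of_pow ((commutingChain_one_of_not_disjoint_range he hf hd).mono
      (rankIdeal_mono (by norm_num)))
  by_cases h2 : transformationRank (a ^ m * b ^ n) ≤ 2
  · exact h_of_pow (commutingChain_one_of_transformationRank_mul_le_two he hf h2)
  obtain ⟨q, hqf, hqa, haq⟩ : ∃ q ∈ Set.range (b ^ n), q ∉ Set.range a ∧
      a q ∈ Set.range (a ^ m) := by
    obtain ⟨N, rfl⟩ := Nat.exists_eq_add_one_of_ne_zero hm
    by_contra! h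
    have := transformationRank_pow_succ_mul_le hd h
    have := transformationRank_mul_le_left (a ^ (N + 1)) (b ^ n)
    have : transformationRank a ≤ 4 := ha
    omega
  obtain ⟨g, hg, hgq, hag⟩ := exists_commute_fixing_of_notMem_range h3 (.self_pow a m) hqa
    (apply_eq_self_of_mem_range he haq)
  exact ⟨g, hg, hag, Function.const X q,
    rankIdeal_mono (by norm_num) (const_mem_rankIdeal_one q), commute_const hgq,
    b ^ n, pow_mem_of_ne_zero _ hb hn,
    (commute_const (apply_eq_self_of_mem_range hf hqf)).symm, .pow_self b n⟩

theorem commutingChain_three_of_card_le_seven [Nonempty X] (hX : Nat.card X ≤ 7)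
    {a b : Function.End X} (ha : a ∈ rankIdeal X 4) (hb : b ∈ rankIdeal X 4) :
    CommutingChain (rankIdeal X 4) 3 a b := by
  obtain ⟨m, hm, he⟩ := exists_pow_isIdempotentElem a
  obtain ⟨n, hn, hf⟩ := exists_pow_isIdempotentElem b
  by_cases hd : Disjoint (Set.range (a ^ m)) (Set.range (b ^ n))
  · have := transformationRank_add_le_card hd
    rcases le_or_gt (transformationRank (a ^ m)) 3 with h | h
    · exact commutingChain_three_of_transformationRank_pow_le_three ha hb hm hn he hf h
    · exact (commutingChain_three_of_transformationRank_pow_le_three hb ha hn hm hf he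
        (by omega)).symm
  · exact .of_pow (pow_mem_of_ne_zero _ ha hm) (pow_mem_of_ne_zero _ hb hn)
      ((commutingChain_one_of_not_disjoint_range he hf hd).mono (rankIdeal_mono (by norm_num)))

end RankFour

/-- All elements of `S` commuting with `a` have the power `e`. A chain in `S` issuing from `a` can
then be rerouted through `e`, so `a` is as far from other elements as possible. -/
def ForcesPower {M : Type*} [Monoid M] (S : Set M) (a e : M) : Prop :=
  ∀ c ∈ S, Commute a c → ∃ n, c ^ n = e

section ForcesPower

variable {M N : Type*} [Monoid M] [Monoid N] {S : Set M} {a b e f : M}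

theorem ForcesPower.map {T : Set N} (h : ForcesPower S a e) (φ : M ≃* N)
    (hφ : Set.MapsTo φ.symm T S) : ForcesPower T (φ a) (φ e) := by
  intro c hc hac
  obtain ⟨n, hn⟩ := h (φ.symm c) (hφ hc) (by simpa using hac.map φ.symm)
  exact ⟨n, by rw [← hn, map_pow, φ.apply_symm_apply]⟩

theorem CommutingChain.of_forcesPower {k : ℕ} (h : CommutingChain S (k + 2) a b)
    (ha : ForcesPower S a e) (hb : ForcesPower S b f) : CommutingChain S k e f := by
  obtain ⟨c, hc, hac, hcb⟩ := h
  obtain ⟨n, rfl⟩ := ha c hc hac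
  obtain ⟨d, hd, hbd, hdc⟩ := hcb.symm
  obtain ⟨l, rfl⟩ := hb d hd hbd
  exact (hdc.pow_left l).symm.pow_left n

end ForcesPower

section EndCongr

variable {X Y : Type*}

/-- The isomorphism of transformation monoids given by relabelling points along `τ`. -/
def endCongr (τ : X ≃ Y) : Function.End X ≃* Function.End Y :=
  { τ.conj with map_mul' := τ.conj_comp }

theorem transformationRank_endCongr (τ : X ≃ Y) (a : Function.End X) :
    transformationRank (endCongr τ a) = transformationRank a := by
  have h_range : Set.range (endCongr τ a) = τ '' Set.range a := by
    rw [← Set.range_comp τ a]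
    exact τ.symm.surjective.range_comp (τ ∘ a)
  rw [transformationRank, h_range, Set.ncard_image_of_injective _ τ.injective, transformationRank]

variable [Finite X] [Finite Y]

theorem mapsTo_endCongr_rankIdeal (τ : X ≃ Y) (r : ℕ) :
    Set.MapsTo (endCongr τ) (rankIdeal X r) (rankIdeal Y r) :=
  fun a ha => (transformationRank_endCongr τ a).trans_le ha

theorem ForcesPower.map_endCongr {r : ℕ} {a e : Function.End X}
    (h : ForcesPower (rankIdeal X r : Set (Function.End X)) a e) (τ : X ≃ Y) :
    ForcesPower (rankIdeal Y r : Set (Function.End Y)) (endCongr τ a) (endCongr τ e) :=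
  h.map (endCongr τ) (mapsTo_endCongr_rankIdeal τ.symm r)

theorem exists_not_commutingChain_of_equiv (τ : X ≃ Y) {r k : ℕ}
    (h : ∃ a ∈ rankIdeal X r, ∃ b ∈ rankIdeal X r, ¬ CommutingChain (rankIdeal X r) k a b) :
    ∃ a ∈ rankIdeal Y r, ∃ b ∈ rankIdeal Y r, ¬ CommutingChain (rankIdeal Y r) k a b := by
  obtain ⟨a, ha, b, hb, hab⟩ := h
  refine ⟨endCongr τ a, mapsTo_endCongr_rankIdeal τ r ha, endCongr τ b,
    mapsTo_endCongr_rankIdeal τ r hb, fun h => hab ?_⟩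
  simpa using h.map (endCongr τ).symm.toMulHom (mapsTo_endCongr_rankIdeal τ.symm r)

end EndCongr

/-- The transformation sending `z` to `x (π z)`. When `π` is a left inverse of `x`, it is the
idempotent retracting `X` onto the points `x i`. -/
def collapse {X ι : Type*} (x : ι → X) (π : X → ι) : Function.End X :=
  x ∘ π

/-- The transformation `a` has a single cycle `x`, of length `m`; `phase z` is the place on the
cycle that stays in step with `z` under `a`, and `depth z` is the distance from `z` to the cycle. -/
structure Unicyclic {X : Type*} {m : ℕ} (a : Function.End X) (x : ZMod m → X)
    (phase : X → ZMod m) (depth : X → ℕ) : Prop where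
  phase_cycle : ∀ i, phase (x i) = i
  map_cycle : ∀ i, a (x i) = x (i + 1)
  phase_map : ∀ z, phase (a z) = phase z + 1
  depth_map : ∀ z, depth (a z) = depth z - 1
  eq_cycle : ∀ z, depth z = 0 → z = x (phase z)

namespace Unicyclic

variable {X : Type*} {m : ℕ} {a c : Function.End X} {x : ZMod m → X} {π : X → ZMod m}
  {δ : X → ℕ}

theorem injective_cycle (h : Unicyclic a x π δ) : Function.Injective x :=
  Function.LeftInverse.injective h.phase_cycle

theorem pow_cycle (h : Unicyclic a x π δ) (k : ℕ) (i : ZMod m) : (a ^ k) (x i) = x (i + k) := by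
  induction k with
  | zero => rw [Nat.cast_zero, add_zero]; rfl
  | succ k ih => rw [pow_succ_apply, ih, h.map_cycle, Nat.cast_succ, add_assoc]

theorem phase_pow (h : Unicyclic a x π δ) (k : ℕ) (z : X) : π ((a ^ k) z) = π z + k := by
  induction k with
  | zero => rw [Nat.cast_zero, add_zero]; rfl
  | succ k ih => rw [pow_succ_apply, h.phase_map, ih, Nat.cast_succ, add_assoc]

theorem depth_pow (h : Unicyclic a x π δ) (k : ℕ) (z : X) : δ ((a ^ k) z) = δ z - k := by
  induction k with
  | zero => rfl
  | succ k ih => rw [pow_succ_apply, h.depth_map, ih, Nat.sub_sub]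

theorem mem_range_pow_of_depth_eq_one (h : Unicyclic a x π δ)
    (h_unique : ∀ z w, δ z = 1 → δ w = 1 → z = w) {k : ℕ} {t : X} (ht : δ t = k + 1) {z : X}
    (hz : δ z = 1) : z ∈ Set.range (a ^ k) :=
  ⟨t, h_unique _ _ (by rw [h.depth_pow]; omega) hz⟩

variable [NeZero m]

theorem depth_apply_cycle (h : Unicyclic a x π δ) (hac : Commute a c) (i : ZMod m) :
    δ (c (x i)) = 0 := by
  have h_period : ∀ k, (a ^ (m * k)) (c (x i)) = c (x i) := fun k => by
    rw [commute_iff_forall_apply.1 (hac.pow_left _), h.pow_cycle]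
    simp
  have := h.depth_pow (m * δ (c (x i))) (c (x i))
  have := Nat.le_mul_of_pos_left (δ (c (x i))) (NeZero.pos m)
  rw [h_period] at *
  omega

theorem exists_pow_apply_eq_cycle (h : Unicyclic a x π δ) (z : X) (i : ZMod m) :
    ∃ n, (a ^ n) z = x i := by
  obtain ⟨j, hj⟩ := ZMod.natCast_zmod_surjective (i - π z)
  have h_depth : δ ((a ^ (m * δ z + j)) z) = 0 := by
    have := Nat.le_mul_of_pos_left (δ z) (NeZero.pos m)
    rw [h.depth_pow]
    omega
  refine ⟨m * δ z + j, ?_⟩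
  rw [h.eq_cycle _ h_depth, h.phase_pow]
  simp [hj]

theorem apply_cycle_eq_self_of_isIdempotentElem (h : Unicyclic a x π δ) (hac : Commute a c)
    (hc : IsIdempotentElem c) (i : ZMod m) : c (x i) = x i := by
  obtain ⟨n, hn⟩ := h.exists_pow_apply_eq_cycle (c (x 0)) i
  rw [← hn, ← commute_iff_forall_apply.1 (hac.pow_left n),
    apply_eq_self_of_mem_range hc (Set.mem_range_self _)]

variable [Finite X]

theorem exists_pow_eq_collapse (h : Unicyclic a x π δ) : ∃ n, a ^ n = collapse x π := by
  obtain ⟨k, hk⟩ := (Set.finite_range δ).bddAbove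
  refine ⟨m * k, funext fun z => ?_⟩
  have h_depth : δ ((a ^ (m * k)) z) = 0 := by
    have := hk ⟨z, rfl⟩
    have := Nat.le_mul_of_pos_left k (NeZero.pos m)
    rw [h.depth_pow]
    omega
  rw [h.eq_cycle _ h_depth, h.phase_pow]
  simp [collapse]

theorem add_depth_le_ncard (h : Unicyclic a x π δ) {s : Set X} (hs : Set.MapsTo a s s) {w : X}
    (hw : w ∈ s) : m + δ w ≤ s.ncard := by
  have h_pow : ∀ n, (a ^ n) w ∈ s := fun n => hs.iterate n hw
  have h_cycle : ∀ i, x i ∈ s := fun i => by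
    obtain ⟨n, hn⟩ := h.exists_pow_apply_eq_cycle w i
    exact hn ▸ h_pow n
  have h_depth : ∀ i, δ (x i) = 0 := h.depth_apply_cycle (.one_right a)
  let ψ : ZMod m ⊕ Fin (δ w) → s :=
    Sum.elim (fun i => ⟨x i, h_cycle i⟩) (fun j => ⟨(a ^ j.1) w, h_pow j⟩)
  have hψ : Function.Injective ψ := by
    refine Function.Injective.sumElim (fun i j hij => h.injective_cycle (congrArg Subtype.val hij))
      (fun i j hij => ?_) (fun i j hij => ?_)
    · have := congrArg (δ ·.1) hij
      simp only [h.depth_pow] at this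
      omega
    · have := congrArg (δ ·.1) hij
      simp only [h.depth_pow, h_depth] at this
      omega
  simpa using Nat.card_le_card_of_injective ψ hψ

theorem depth_apply_le_of_commute (h : Unicyclic a x π δ) (hac : Commute a c) {k : ℕ}
    (hc : c ∈ rankIdeal X (m + k)) (z : X) : δ (c z) ≤ k := by
  have h_maps : Set.MapsTo a (Set.range c) (Set.range c) := by
    rintro _ ⟨w, rfl⟩
    exact ⟨a w, (commute_iff_forall_apply.1 hac w).symm⟩
  have := (h.add_depth_le_ncard h_maps ⟨z, rfl⟩).trans hc
  omega

theorem phase_apply_of_isIdempotentElem (h : Unicyclic a x π δ) (hac : Commute a c)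
    (hc : IsIdempotentElem c) (z : X) : π (c z) = π z := by
  obtain ⟨n, hn⟩ := h.exists_pow_eq_collapse
  have h_comm : x (π (c z)) = c (x (π z)) :=
    commute_iff_forall_apply.1 (hn ▸ hac.pow_left n : Commute (collapse x π) c) z
  exact h.injective_cycle (h_comm.trans (h.apply_cycle_eq_self_of_isIdempotentElem hac hc _))

theorem eq_collapse_of_isIdempotentElem (h : Unicyclic a x π δ) {k : ℕ}
    (hk : ∀ z, δ z = 1 → z ∈ Set.range (a ^ k)) (hac : Commute a c)
    (hc : c ∈ rankIdeal X (m + k)) (hcc : IsIdempotentElem c) : c = collapse x π := by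
  suffices h_depth : ∀ z, δ (c z) = 0 by
    funext z
    rw [h.eq_cycle _ (h_depth z), h.phase_apply_of_isIdempotentElem hac hcc]
    rfl
  intro z
  -- Otherwise the last point off the cycle on the way of `c z` is `(a ^ k) t` for some `t`, and
  -- `c t` reaches it after `k` steps as well, so `c t` has depth `k + 1`.
  by_contra h_pos
  obtain ⟨d, hd⟩ := Nat.exists_eq_add_one_of_ne_zero h_pos
  have hw : δ ((a ^ d) (c z)) = 1 := by rw [h.depth_pow]; omega
  obtain ⟨t, ht⟩ := hk _ hw
  have h_fixed : (a ^ k) (c t) = (a ^ k) t := by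
    rw [commute_iff_forall_apply.1 (hac.pow_left k), ht,
      commute_iff_forall_apply.1 (hac.pow_left d), apply_eq_self_of_mem_range hcc ⟨_, rfl⟩]
  have := h.depth_apply_le_of_commute hac hc t
  rw [← ht, ← h_fixed, h.depth_pow] at hw
  omega

theorem forcesPower (h : Unicyclic a x π δ) {k : ℕ}
    (hk : ∀ z, δ z = 1 → z ∈ Set.range (a ^ k)) :
    ForcesPower (rankIdeal X (m + k) : Set (Function.End X)) a (collapse x π) := by
  intro c hc hac
  obtain ⟨n, hn, hcn⟩ := exists_pow_isIdempotentElem c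
  exact ⟨n, h.eq_collapse_of_isIdempotentElem hk (hac.pow_right n) (pow_mem_of_ne_zero _ hc hn) hcn⟩

end Unicyclic

/-- Two disjoint `m`-cycles `x` and `y`, where `π` assigns to every point a place on `x` and `ρ` a
place on `y`, so that passing from `x` to `y` and back along `ρ` and `π` rotates `x` by one step.
It describes how the cycles of two unicyclic transformations are placed against each other. -/
structure CrossedCycles {X : Type*} {m : ℕ} (x y : ZMod m → X) (π ρ : X → ZMod m)
    (s u : ZMod m) : Prop where
  ne : ∀ i j, x i ≠ y j
  phase_left : ∀ i, π (x i) = i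
  phase_right : ∀ i, ρ (y i) = i
  phase_left_right : ∀ i, π (y i) = i + s
  phase_right_left : ∀ i, ρ (x i) = i + u
  add_eq_one : s + u = 1

namespace CrossedCycles

variable {X : Type*} {m : ℕ} {x y : ZMod m → X} {π ρ : X → ZMod m} {s u : ZMod m}
  {g : Function.End X}

theorem symm (h : CrossedCycles x y π ρ s u) : CrossedCycles y x ρ π u s where
  ne i j := (h.ne j i).symm
  phase_left := h.phase_right
  phase_right := h.phase_left
  phase_left_right := h.phase_right_left
  phase_right_left := h.phase_left_right
  add_eq_one := by rw [add_comm, h.add_eq_one]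

theorem injective_left (h : CrossedCycles x y π ρ s u) : Function.Injective x :=
  Function.LeftInverse.injective h.phase_left

theorem not_commute_collapse (h : CrossedCycles x y π ρ s u) :
    ¬ Commute (collapse x π) (collapse y ρ) :=
  fun hxy => h.ne _ _ (commute_iff_forall_apply.1 hxy (x 0))

theorem apply_left_eq (h : CrossedCycles x y π ρ s u) (hx : Commute g (collapse x π)) (i : ZMod m) :
    g (x i) = x (π (g (x i))) := by
  simpa [collapse, h.phase_left] using commute_iff_forall_apply.1 hx (x i)

theorem exists_shift_of_commute [NeZero m] (h : CrossedCycles x y π ρ s u)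
    (hx : Commute g (collapse x π)) (hy : Commute g (collapse y ρ)) :
    ∃ j, ∀ i, g (x i) = x (i + j) := by
  have h_step : ∀ i j, g (x i) = x j → g (x (i + 1)) = x (j + 1) := fun i j hij => by
    have h_loop : collapse x π (collapse y ρ (x i)) = x (i + 1) ∧
        collapse x π (collapse y ρ (x j)) = x (j + 1) := by
      simp [collapse, h.phase_right_left, h.phase_left_right, add_assoc, add_comm u,
        h.add_eq_one]
    rw [← h_loop.1, ← h_loop.2, commute_iff_forall_apply.1 hx, commute_iff_forall_apply.1 hy, hij]
  refine ⟨π (g (x 0)), fun i => ?_⟩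
  obtain ⟨n, rfl⟩ := ZMod.natCast_zmod_surjective i
  induction n with
  | zero => simpa using h.apply_left_eq hx 0
  | succ n ih => rw [Nat.cast_succ, h_step _ _ ih, add_right_comm]

theorem range_left_subset_of_commute [NeZero m] (h : CrossedCycles x y π ρ s u)
    (hx : Commute g (collapse x π)) (hy : Commute g (collapse y ρ)) :
    Set.range x ⊆ Set.range g := by
  obtain ⟨j, hj⟩ := h.exists_shift_of_commute hx hy
  rintro _ ⟨i, rfl⟩
  exact ⟨x (i - j), by rw [hj, sub_add_cancel]⟩

theorem range_union_subset_of_commute [NeZero m] (h : CrossedCycles x y π ρ s u)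
    (hx : Commute g (collapse x π)) (hy : Commute g (collapse y ρ)) :
    Set.range x ∪ Set.range y ⊆ Set.range g :=
  Set.union_subset (h.range_left_subset_of_commute hx hy)
    (h.symm.range_left_subset_of_commute hy hx)

theorem ncard_range_union [NeZero m] (h : CrossedCycles x y π ρ s u) :
    (Set.range x ∪ Set.range y).ncard = 2 * m := by
  have h_disj : Disjoint (Set.range x) (Set.range y) := by
    rw [Set.disjoint_range_iff]
    exact h.ne
  rw [Set.ncard_union_eq h_disj (Set.finite_range x) (Set.finite_range y),
    Set.ncard_range_of_injective h.injective_left,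
    Set.ncard_range_of_injective h.symm.injective_left, Nat.card_zmod, two_mul]

theorem phase_apply_of_isIdempotentElem [NeZero m] (h : CrossedCycles x y π ρ s u)
    (hx : Commute g (collapse x π)) (hy : Commute g (collapse y ρ)) (hg : IsIdempotentElem g)
    (w : X) : π (g w) = π w := by
  have h_fix : g (x (π w)) = x (π w) :=
    apply_eq_self_of_mem_range hg (h.range_left_subset_of_commute hx hy ⟨_, rfl⟩)
  exact h.injective_left ((commute_iff_forall_apply.1 hx w).symm.trans h_fix)

theorem apply_notMem_range_of_isIdempotentElem [NeZero m] (h : CrossedCycles x y π ρ s u)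
    (hx : Commute g (collapse x π)) (hy : Commute g (collapse y ρ)) (hg : IsIdempotentElem g)
    {w : X} (hw : ρ w ≠ π w + u) : g w ∉ Set.range x := by
  rintro ⟨i, hi⟩
  have hπ := h.phase_apply_of_isIdempotentElem hx hy hg w
  have hρ := h.symm.phase_apply_of_isIdempotentElem hy hx hg w
  rw [← hi, h.phase_left] at hπ
  rw [← hi, h.phase_right_left, hπ] at hρ
  exact hw hρ.symm

variable [Finite X] [NeZero m]

theorem two_mul_le_transformationRank (h : CrossedCycles x y π ρ s u)
    (hx : Commute g (collapse x π)) (hy : Commute g (collapse y ρ)) :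
    2 * m ≤ transformationRank g :=
  h.ncard_range_union ▸ Set.ncard_le_ncard (h.range_union_subset_of_commute hx hy) (Set.toFinite _)

theorem two_mul_lt_transformationRank (h : CrossedCycles x y π ρ s u)
    (hx : Commute g (collapse x π)) (hy : Commute g (collapse y ρ)) {w : X}
    (hwx : ρ w ≠ π w + u) (hwy : π w ≠ ρ w + s) : 2 * m < transformationRank g := by
  obtain ⟨n, hn, hgn⟩ := exists_pow_isIdempotentElem g
  have h_rank : transformationRank (g ^ n) ≤ transformationRank g :=
    pow_mem_of_ne_zero (rankIdeal X (transformationRank g)) (le_refl (transformationRank g)) hn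
  refine lt_of_lt_of_le ?_ h_rank
  have hxn := hx.pow_left n
  have hyn := hy.pow_left n
  have h_notMem : (g ^ n) w ∉ Set.range x ∪ Set.range y := by
    rintro (h_mem | h_mem)
    · exact h.apply_notMem_range_of_isIdempotentElem hxn hyn hgn hwx h_mem
    · exact h.symm.apply_notMem_range_of_isIdempotentElem hyn hxn hgn hwy h_mem
  rw [← h.ncard_range_union]
  exact Set.ncard_lt_ncard ⟨h.range_union_subset_of_commute hxn hyn,
    fun h_sub => h_notMem (h_sub ⟨w, rfl⟩)⟩ (Set.toFinite _)

theorem not_commutingChain_one_of_lt (h : CrossedCycles x y π ρ s u) {r : ℕ} (hr : r < 2 * m) :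
    ¬ CommutingChain (rankIdeal X r) 1 (collapse x π) (collapse y ρ) := by
  rintro ⟨g, hg, hx, hy⟩
  exact hr.not_ge ((h.two_mul_le_transformationRank hx.symm hy).trans hg)

theorem not_commutingChain_one_of_le (h : CrossedCycles x y π ρ s u) {w : X}
    (hwx : ρ w ≠ π w + u) (hwy : π w ≠ ρ w + s) {r : ℕ} (hr : r ≤ 2 * m) :
    ¬ CommutingChain (rankIdeal X r) 1 (collapse x π) (collapse y ρ) := by
  rintro ⟨g, hg, hx, hy⟩
  exact hr.not_gt ((h.two_mul_lt_transformationRank hx.symm hy hwx hwy).trans_le hg)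

end CrossedCycles

theorem zmod_val_neg_one {m : ℕ} [NeZero m] : (-1 : ZMod m).val = m - 1 := by
  obtain ⟨n, rfl⟩ := Nat.exists_eq_succ_of_ne_zero (NeZero.ne m)
  exact ZMod.val_neg_one n

theorem zmod_val_add_one_of_ne_neg_one {m : ℕ} [NeZero m] {i : ZMod m} (hi : i ≠ -1) :
    (i + 1).val = i.val + 1 := by
  have h_lt := i.val_lt
  have h_ne : i.val ≠ m - 1 := fun h => hi (ZMod.val_injective _ (h.trans zmod_val_neg_one.symm))
  have : Fact (1 < m) := ⟨by omega⟩
  rw [ZMod.val_add_of_lt (by rw [ZMod.val_one]; omega), ZMod.val_one]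

/-- Two copies of the cycle `ZMod m`, together with further points `W`. -/
abbrev TwoCycles (m : ℕ) (W : Type*) : Type _ := (ZMod m ⊕ ZMod m) ⊕ W

namespace TwoCycles

variable {m : ℕ} {W : Type*}

/-- The first of the two cycles. -/
def mainCycle (i : ZMod m) : TwoCycles m W := .inl (.inl i)

/-- The exchange of the two cycles. It turns a transformation whose cycle is `mainCycle` into one
with the other cycle. -/
def swap : TwoCycles m W ≃ TwoCycles m W :=
  Equiv.sumCongr (Equiv.sumComm _ _) (Equiv.refl W)

/-- Rotation of `mainCycle`, where the other copy of `ZMod m` is cut after `-1` into a path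
`0, …, -1` leading to the point `s` of `mainCycle`; the points of `W` are sent to the point `c` of
this path. For `c = 0` the rank is at most `2 * m`; for `c = 1` the start `0` of the path drops
out of the range. -/
def pathMap (s c : ZMod m) : Function.End (TwoCycles m W)
  | .inl (.inl i) => .inl (.inl (i + 1))
  | .inl (.inr i) => if i = -1 then .inl (.inl s) else .inl (.inr (i + 1))
  | .inr _ => .inl (.inr c)

/-- The place on `mainCycle` that stays in step with a point under `pathMap s c`. -/
def pathPhase (s c : ZMod m) : TwoCycles m W → ZMod m
  | .inl (.inl i) => i
  | .inl (.inr i) => i + s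
  | .inr _ => c + s - 1

/-- The number of steps that `pathMap s c` takes to bring a point to `mainCycle`. -/
def pathDepth (c : ZMod m) : TwoCycles m W → ℕ
  | .inl (.inl _) => 0
  | .inl (.inr i) => m - i.val
  | .inr _ => m - c.val + 1

/-- Rotation of `mainCycle`, with all other points sent directly to `mainCycle`. -/
def starMap (s : ZMod m) : Function.End (TwoCycles m W)
  | .inl (.inl i) => .inl (.inl (i + 1))
  | .inl (.inr i) => .inl (.inl (i + s + 1))
  | .inr _ => .inl (.inl 0)

/-- The place on `mainCycle` that stays in step with a point under `starMap s`. -/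
def starPhase (s : ZMod m) : TwoCycles m W → ZMod m
  | .inl (.inl i) => i
  | .inl (.inr i) => i + s
  | .inr _ => -1

/-- The number of steps that `starMap s` takes to bring a point to `mainCycle`. -/
def starDepth : TwoCycles m W → ℕ
  | .inl (.inl _) => 0
  | _ => 1

theorem unicyclic_starMap (s : ZMod m) :
    Unicyclic (starMap s : Function.End (TwoCycles m W)) mainCycle (starPhase s) starDepth where
  phase_cycle _ := rfl
  map_cycle _ := rfl
  phase_map := by
    rintro ((i | i) | w)
    · rfl
    · rfl
    · simp [starMap, starPhase]
  depth_map := by rintro ((i | i) | w) <;> rfl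
  eq_cycle := by
    rintro ((i | i) | w) h
    · rfl
    · cases h
    · cases h

theorem crossedCycles_starPhase {s u : ZMod m} (hsu : s + u = 1) :
    CrossedCycles (mainCycle : _ → TwoCycles m W) (swap ∘ mainCycle) (starPhase s)
      (starPhase u ∘ swap.symm) s u where
  ne _ _ := by simp [mainCycle, swap]
  phase_left _ := rfl
  phase_right _ := rfl
  phase_left_right _ := rfl
  phase_right_left _ := rfl
  add_eq_one := hsu

theorem crossedCycles_pathPhase (c : ZMod m) {s u : ZMod m} (hsu : s + u = 1) :
    CrossedCycles (mainCycle : _ → TwoCycles m W) (swap ∘ mainCycle) (pathPhase s c)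
      (pathPhase u c ∘ swap.symm) s u where
  ne _ _ := by simp [mainCycle, swap]
  phase_left _ := rfl
  phase_right _ := rfl
  phase_left_right _ := rfl
  phase_right_left _ := rfl
  add_eq_one := hsu

theorem range_pathMap_subset (s c : ZMod m) :
    Set.range (pathMap s c : Function.End (TwoCycles m W)) ⊆ Set.range Sum.inl := by
  rintro _ ⟨(i | i) | w, rfl⟩ <;> simp only [pathMap]
  · exact ⟨_, rfl⟩
  · split_ifs <;> exact ⟨_, rfl⟩
  · exact ⟨_, rfl⟩

theorem pathMap_ne_of_ne_zero (s : ZMod m) {c : ZMod m} (hc : c ≠ 0) (z : TwoCycles m W) :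
    pathMap s c z ≠ .inl (.inr 0) := by
  obtain (i | i) | w := z <;> simp only [pathMap]
  · simp
  · split_ifs with hi
    · simp
    · simpa [← eq_neg_iff_add_eq_zero] using hi
  · simpa using hc

variable [NeZero m]

theorem ncard_range_inl : (Set.range (Sum.inl : _ → TwoCycles m W)).ncard = 2 * m := by
  rw [Set.ncard_range_of_injective Sum.inl_injective, Nat.card_sum, Nat.card_zmod, two_mul]

theorem unicyclic_pathMap (s c : ZMod m) :
    Unicyclic (pathMap s c : Function.End (TwoCycles m W)) mainCycle (pathPhase s c)
      (pathDepth c) where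
  phase_cycle _ := rfl
  map_cycle _ := rfl
  phase_map := by
    rintro ((i | i) | w)
    · rfl
    · by_cases hi : i = -1
      · simp [pathMap, pathPhase, hi]
      · simp only [pathMap, hi, if_false, pathPhase]
        ring
    · simp only [pathMap, pathPhase]
      ring
  depth_map := by
    rintro ((i | i) | w)
    · rfl
    · have := NeZero.pos m
      by_cases hi : i = -1
      · simp only [pathMap, pathDepth, hi, if_true, zmod_val_neg_one]
        omega
      · simp only [pathMap, hi, if_false, pathDepth, zmod_val_add_one_of_ne_neg_one hi]
        omega
    · simp [pathMap, pathDepth]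
  eq_cycle := by
    rintro ((i | i) | w) h
    · rfl
    · have := i.val_lt
      simp only [pathDepth] at h
      omega
    · simp [pathDepth] at h

theorem eq_of_pathDepth_eq_one {c : ZMod m} {z : TwoCycles m W} (hz : pathDepth c z = 1) :
    z = .inl (.inr (-1)) := by
  obtain (i | i) | w := z
  · cases hz
  · simp only [pathDepth] at hz
    have hi : i = -1 := ZMod.val_injective _ (by rw [zmod_val_neg_one]; omega)
    rw [hi]
  · have := c.val_lt
    simp only [pathDepth] at hz
    omega

variable [Finite W]

theorem starMap_mem_rankIdeal (s : ZMod m) : starMap s ∈ rankIdeal (TwoCycles m W) m := by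
  have h_sub : Set.range (starMap s : Function.End (TwoCycles m W)) ⊆ Set.range mainCycle := by
    rintro _ ⟨(i | i) | w, rfl⟩ <;> exact ⟨_, rfl⟩
  refine (Set.ncard_le_ncard h_sub (Set.finite_range _)).trans_eq ?_
  rw [Set.ncard_range_of_injective (unicyclic_starMap s).injective_cycle, Nat.card_zmod]

theorem pathMap_mem_rankIdeal (s c : ZMod m) :
    pathMap s c ∈ rankIdeal (TwoCycles m W) (2 * m) :=
  (Set.ncard_le_ncard (range_pathMap_subset s c) (Set.toFinite _)).trans_eq ncard_range_inl

theorem pathMap_mem_rankIdeal_of_ne_zero (s : ZMod m) {c : ZMod m} (hc : c ≠ 0) :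
    pathMap s c ∈ rankIdeal (TwoCycles m W) (2 * m - 1) := by
  have h_sub : Set.range (pathMap s c : Function.End (TwoCycles m W)) ⊆
      Set.range Sum.inl \ {.inl (.inr 0)} :=
    Set.subset_sdiff_singleton (range_pathMap_subset s c)
      (by rintro ⟨z, hz⟩; exact pathMap_ne_of_ne_zero s hc z hz)
  refine (Set.ncard_le_ncard h_sub (Set.toFinite _)).trans_eq ?_
  rw [Set.ncard_sdiff_singleton_of_mem (Set.mem_range_self _), ncard_range_inl]

theorem forcesPower_starMap (s : ZMod m) :
    ForcesPower (rankIdeal (TwoCycles m W) m : Set (Function.End (TwoCycles m W))) (starMap s)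
      (collapse mainCycle (starPhase s)) :=
  (unicyclic_starMap s).forcesPower (k := 0) fun z _ => ⟨z, rfl⟩

theorem forcesPower_pathMap (s c : ZMod m) {k : ℕ} {t : TwoCycles m W}
    (ht : pathDepth c t = k + 1) :
    ForcesPower (rankIdeal (TwoCycles m W) (m + k) : Set (Function.End (TwoCycles m W)))
      (pathMap s c) (collapse mainCycle (pathPhase s c)) :=
  (unicyclic_pathMap s c).forcesPower fun _ hz =>
    (unicyclic_pathMap s c).mem_range_pow_of_depth_eq_one
      (fun _ _ hz hw => (eq_of_pathDepth_eq_one hz).trans (eq_of_pathDepth_eq_one hw).symm) ht hz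

theorem forcesPower_pathMap_zero [Nonempty W] (s : ZMod m) :
    ForcesPower (rankIdeal (TwoCycles m W) (2 * m) : Set (Function.End (TwoCycles m W)))
      (pathMap s 0) (collapse mainCycle (pathPhase s 0)) :=
  two_mul m ▸ forcesPower_pathMap s 0 (t := .inr (Classical.arbitrary W)) (by simp [pathDepth])

theorem forcesPower_pathMap_one (hm : 2 ≤ m) (s : ZMod m) :
    ForcesPower (rankIdeal (TwoCycles m W) (2 * m - 1) : Set (Function.End (TwoCycles m W)))
      (pathMap s 1) (collapse mainCycle (pathPhase s 1)) := by
  have h_depth : pathDepth 1 (.inl (.inr 0) : TwoCycles m W) = m - 1 + 1 := by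
    simp only [pathDepth, ZMod.val_zero]
    omega
  have h_forces := forcesPower_pathMap s 1 h_depth
  rwa [show m + (m - 1) = 2 * m - 1 by omega] at h_forces

theorem not_commutingChain_starMap :
    ¬ CommutingChain (rankIdeal (TwoCycles m W) m) 3 (starMap 0 : Function.End (TwoCycles m W))
      (endCongr swap (starMap 1)) :=
  fun h => (crossedCycles_starPhase (zero_add 1)).not_commutingChain_one_of_lt
    (lt_two_mul_self (NeZero.pos m))
    (h.of_forcesPower (forcesPower_starMap 0) ((forcesPower_starMap 1).map_endCongr swap))

theorem not_commutingChain_pathMap_one (hm : 2 ≤ m) :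
    ¬ CommutingChain (rankIdeal (TwoCycles m W) (2 * m - 1)) 3
      (pathMap 0 1 : Function.End (TwoCycles m W)) (endCongr swap (pathMap 1 1)) :=
  fun h => (crossedCycles_pathPhase 1 (zero_add 1)).not_commutingChain_one_of_lt (by omega)
    (h.of_forcesPower (forcesPower_pathMap_one hm 0)
      ((forcesPower_pathMap_one hm 1).map_endCongr swap))

theorem not_commutingChain_two_pathMap_zero [Nonempty W] :
    ¬ CommutingChain (rankIdeal (TwoCycles m W) (2 * m)) 2
      (pathMap 0 0 : Function.End (TwoCycles m W)) (endCongr swap (pathMap 1 0)) :=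
  fun h => (crossedCycles_pathPhase 0 (zero_add 1)).not_commute_collapse
    (h.of_forcesPower (forcesPower_pathMap_zero 0)
      ((forcesPower_pathMap_zero 1).map_endCongr swap))

theorem not_commutingChain_three_pathMap_zero [Nonempty W] (hm : 3 ≤ m) :
    ¬ CommutingChain (rankIdeal (TwoCycles m W) (2 * m)) 3
      (pathMap (-1) 0 : Function.End (TwoCycles m W)) (endCongr swap (pathMap 2 0)) := by
  have : Fact (1 < m) := ⟨by omega⟩
  have h_two : (2 : ZMod m) ≠ 0 := by
    have := (ZMod.natCast_eq_zero_iff 2 m).not.2 (Nat.not_dvd_of_pos_of_lt two_pos hm)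
    exact_mod_cast this
  -- The shifts `-1` and `2` keep the points of `W` out of step with both cycles, since neither `1`
  -- nor `2` vanishes in `ZMod m`.
  let w : TwoCycles m W := .inr (Classical.arbitrary W)
  have hwx : (pathPhase 2 0 ∘ swap.symm) w ≠ pathPhase (-1) 0 w + 2 := by
    change (0 + 2 - 1 : ZMod m) ≠ 0 + -1 - 1 + 2
    exact fun h => one_ne_zero (α := ZMod m) (by linear_combination h)
  have hwy : pathPhase (-1) 0 w ≠ (pathPhase 2 0 ∘ swap.symm) w + -1 := by
    change (0 + -1 - 1 : ZMod m) ≠ 0 + 2 - 1 + -1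
    exact fun h => h_two (by linear_combination -h)
  exact fun h => (crossedCycles_pathPhase 0 (by ring)).not_commutingChain_one_of_le hwx hwy le_rfl
    (h.of_forcesPower (forcesPower_pathMap_zero (-1))
      ((forcesPower_pathMap_zero 2).map_endCongr swap))

theorem nonempty_equiv {X : Type*} [Finite X] (hX : 2 * m ≤ Nat.card X) :
    Nonempty (TwoCycles m (Fin (Nat.card X - 2 * m)) ≃ X) := by
  rw [← Finite.card_eq, Nat.card_sum, Nat.card_sum, Nat.card_zmod, Nat.card_fin]
  omega

end TwoCycles

section DistantPairs

open TwoCycles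

variable {X : Type*} [Finite X] {m : ℕ}

theorem exists_not_commutingChain_three_rankIdeal (hm : 1 ≤ m) (hX : 2 * m ≤ Nat.card X) :
    ∃ a ∈ rankIdeal X m, ∃ b ∈ rankIdeal X m, ¬ CommutingChain (rankIdeal X m) 3 a b := by
  have : NeZero m := ⟨by omega⟩
  obtain ⟨τ⟩ := nonempty_equiv hX
  exact exists_not_commutingChain_of_equiv τ ⟨_, starMap_mem_rankIdeal _, _,
    mapsTo_endCongr_rankIdeal swap _ (starMap_mem_rankIdeal _), not_commutingChain_starMap⟩

theorem exists_not_commutingChain_three_rankIdeal_two_mul_sub_one (hm : 2 ≤ m)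
    (hX : 2 * m ≤ Nat.card X) :
    ∃ a ∈ rankIdeal X (2 * m - 1), ∃ b ∈ rankIdeal X (2 * m - 1),
      ¬ CommutingChain (rankIdeal X (2 * m - 1)) 3 a b := by
  have : NeZero m := ⟨by omega⟩
  have : Fact (1 < m) := ⟨hm⟩
  obtain ⟨τ⟩ := nonempty_equiv hX
  exact exists_not_commutingChain_of_equiv τ
    ⟨_, pathMap_mem_rankIdeal_of_ne_zero _ one_ne_zero, _,
      mapsTo_endCongr_rankIdeal swap _ (pathMap_mem_rankIdeal_of_ne_zero _ one_ne_zero),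
      not_commutingChain_pathMap_one hm⟩

theorem exists_not_commutingChain_two_rankIdeal_two_mul (hm : 1 ≤ m) (hX : 2 * m < Nat.card X) :
    ∃ a ∈ rankIdeal X (2 * m), ∃ b ∈ rankIdeal X (2 * m),
      ¬ CommutingChain (rankIdeal X (2 * m)) 2 a b := by
  have : NeZero m := ⟨by omega⟩
  have : Nonempty (Fin (Nat.card X - 2 * m)) := ⟨0, by omega⟩
  obtain ⟨τ⟩ := nonempty_equiv hX.le
  exact exists_not_commutingChain_of_equiv τ ⟨_, pathMap_mem_rankIdeal _ _, _,
    mapsTo_endCongr_rankIdeal swap _ (pathMap_mem_rankIdeal _ _),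
    not_commutingChain_two_pathMap_zero⟩

theorem exists_not_commutingChain_three_rankIdeal_two_mul (hm : 3 ≤ m)
    (hX : 2 * m < Nat.card X) :
    ∃ a ∈ rankIdeal X (2 * m), ∃ b ∈ rankIdeal X (2 * m),
      ¬ CommutingChain (rankIdeal X (2 * m)) 3 a b := by
  have : NeZero m := ⟨by omega⟩
  have : Nonempty (Fin (Nat.card X - 2 * m)) := ⟨0, by omega⟩
  obtain ⟨τ⟩ := nonempty_equiv hX.le
  exact exists_not_commutingChain_of_equiv τ ⟨_, pathMap_mem_rankIdeal _ _, _,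
    mapsTo_endCongr_rankIdeal swap _ (pathMap_mem_rankIdeal _ _),
    not_commutingChain_three_pathMap_zero hm⟩

end DistantPairs

theorem mainTheorem1 {X : Type*} [Finite X] (n r : ℕ) (hX : Nat.card X = n)
    (hn : 3 ≤ n) (hr : 2 ≤ r) (hrn : r < n) :
    ((n = 3 ∨ ((n = 5 ∨ n = 6 ∨ n = 7) ∧ r = 4)) →
      (commutingGraph (rankIdeal X r)).ediam = 4) ∧
    (¬ (n = 3 ∨ ((n = 5 ∨ n = 6 ∨ n = 7) ∧ r = 4)) →
      (commutingGraph (rankIdeal X r)).ediam = 5) := by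
  subst hX
  have : Nonempty X := (Nat.card_pos_iff.1 (by omega)).1
  have h_center := center_rankIdeal_eq_empty (X := X) (by omega) hrn
  refine ⟨fun h => ?_, fun h => ?_⟩
  · refine (ediam_commutingGraph_eq_iff h_center (k := 2)).2 ⟨?_, ?_⟩
    · rcases h with h | ⟨h, rfl⟩
      · exact fun a ha b hb => commutingChain_add_two_of_isIdempotentElem
          (fun e _ f _ he hf =>
            (commutingChain_one_of_card_le_three h.le he hf).mono (rankIdeal_mono hr)) ha hb
      · exact fun a ha b hb => commutingChain_three_of_card_le_seven (by omega) ha hb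
    · obtain ⟨m, rfl⟩ : 2 ∣ r := by omega
      exact exists_not_commutingChain_two_rankIdeal_two_mul (by omega) hrn
  · refine (ediam_commutingGraph_eq_iff h_center (k := 3)).2 ⟨fun a ha b hb => ?_, ?_⟩
    · exact commutingChain_add_two_of_isIdempotentElem (fun e _ f _ he hf =>
        (commutingChain_two_of_isIdempotentElem he hf).mono (rankIdeal_mono hr)) ha hb
    · rcases Nat.even_or_odd' r with ⟨m, rfl | rfl⟩
      · rcases le_or_gt 3 m with hm | hm
        · exact exists_not_commutingChain_three_rankIdeal_two_mul hm hrn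
        · exact exists_not_commutingChain_three_rankIdeal (by omega) (by omega)
      · exact exists_not_commutingChain_three_rankIdeal_two_mul_sub_one (m := m + 1) (by omega)
          hrn
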